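/- **Setting.** Let $F$ be a Fréchet space, i.e. a complete, metrizable, locally convex Hausdorff real topological vector space. A map $f$ from an open subset $U$ of $F$ into a Fréchet space $G$ is *Keller $C^1$* if it is continuous, its directional derivatives $Df(x)h=\lim_{t\to0}\frac{f(x+th)-f(x)}{t}$ exist for all $x\in U$, $h\in F$, each $Df(x)$ is a continuous linear map, and $x\mapsto Df(x)$ is continuous from $U$ into the space of continuous linear maps $F\to G$ with the topology of uniform convergence on compact sets. A *$C^1$-Fréchet manifold* modelled on $F$ is a second countable Hausdorff space $M$ with an atlas of charts onto open subsets of $F$ whose transition maps are Keller $C^1$. A functional $\varphi:M\to\mathbb R$ is $C^1$ if $\varphi\circ\psi^{-1}$ is Keller $C^1$ for every chart $\psi$. Write $\varphi'(x,h)=D(\varphi\circ\psi^{-1})(\psi(x))\,\psi_*h$ for $h\in T_xM$. A point $x$ is a *critical point* of $\varphi$ if $D(\varphi\circ\psi^{-1})(\psi(x))=0$ for a chart $\psi$ at $x$. A *graded Finsler structure* on $M$ is a sequence of continuous functions $\|\cdot\|_n:TM\to[0,\infty)$, $n\ge1$, which restrict to seminorms $\|\cdot\|_n^x$ on each $T_xM$,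 satisfy $\|\cdot\|_n\le\|\cdot\|_{n+1}$, and are such that around each point of $M$ there is a bundle chart $TM|_U\cong U\times F$ in which the resulting functions $p_n(w,v)$ on $U\times F$ are continuous and satisfy the following: for each $w\in U$ the seminorms $p_n(w,\cdot)$ define the topology of $F$; and for all $k>1$ and $w_0\in U$ there is a neighbourhood $W$ of $w_0$ with $\frac1k p_n(w_0,v)\le p_n(w,v)\le k\,p_n(w_0,v)$ for all $w\in W$, $n\ge1$, $v\in F$. Let $\rho_n(x,y)$ be the infimum of the lengths $\int\|\gamma'(t)\|_n^{\gamma(t)}\,dt$ over the piecewise $C^1$ curves $\gamma$ from $x$ to $y$, and $$\rho(x,y)=\sum_{n=1}^\infty\frac1{2^n}\,\frac{\rho_n(x,y)}{1+\rho_n(x,y)}$$ the *Finsler metric*. For a $C^1$ functional $\varphi$ put $$\Phi_\varphi(x)=\inf\{\varphi'(x,h): h\in T_xM,\ \|h\|_n^x\le1\text{ for all }n\}.$$ The functional $\varphi$ satisfies the *Palais–Smale condition at the level $c$* if every sequence $(m_i)$ in $M$ with $\varphi(m_i)\to c$ and $\Phi_\varphi(m_i)\to0$ has a convergent subsequence.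 It is *closed* if it maps closed subsets of $M$ to closed subsets of $\mathbb R$. **Theorem (Three Critical Points Theorem).** Let $M$ be a connected $C^1$-Fréchet manifold with a graded Finsler structure whose Finsler metric $\rho$ is complete, and let $\varphi:M\to\mathbb R$ be a closed $C^1$ functional satisfying the Palais–Smale condition at all levels $c\in\mathbb R$. If $x_0\ne x_1$ are local minimum points of $\varphi$, then $x_0$ and $x_1$ are critical points of $\varphi$, and $\varphi$ has a third critical point, different from $x_0$ and from $x_1$. -/

import Mathlib

open Set Filter Topology Bundle MeasureTheory
open scoped CompactConvergenceCLM

noncomputable section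

namespace FrechetCrit

/-! ### Keller `C¹` maps between topological vector spaces -/

section Keller

variable {E G : Type*} [AddCommGroup E] [Module ℝ E] [TopologicalSpace E]
  [AddCommGroup G] [Module ℝ G] [TopologicalSpace G]

/-- `d` is the directional derivative `lim_{t → 0} (f (x + t h) - f x) / t`. -/
def HasDirDeriv (f : E → G) (x h : E) (d : G) : Prop :=
  Tendsto (fun t : ℝ => t⁻¹ • (f (x + t • h) - f x)) (𝓝[≠] 0) (𝓝 d)

/-- The directional derivative of `f` at `x` in the direction `h` (meaningful where it exists). -/
def dirDeriv (f : E → G) (x h : E) : G :=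
  limUnder (𝓝[≠] (0 : ℝ)) (fun t : ℝ => t⁻¹ • (f (x + t • h) - f x))

/-- `f` is a Keller `C¹` map on the (open) set `U`: it is continuous, all its directional
derivatives exist, they form a continuous linear map `f' x` at each point `x` of `U`, and
`x ↦ f' x` is continuous on `U` for the topology of uniform convergence on compact sets. -/
def IsKellerC1On [IsTopologicalAddGroup G] [ContinuousConstSMul ℝ G]
    (f : E → G) (U : Set E) : Prop :=
  ContinuousOn f U ∧ ∃ f' : E → (E →L_c[ℝ] G),
    (∀ x ∈ U, ∀ h : E, HasDirDeriv f x h (f' x h)) ∧ ContinuousOn f' U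

end Keller

/-! ### Manifolds, tangent vectors and the tangent bundle -/

section Manifold

variable (F : Type*) [AddCommGroup F] [Module ℝ F] [TopologicalSpace F]
  {M : Type*} [TopologicalSpace M] [ChartedSpace F M]

variable (M) in
/-- The transition maps between the charts of the atlas are Keller `C¹` maps. -/
def IsKellerC1Atlas [IsTopologicalAddGroup F] [ContinuousSMul ℝ F] : Prop :=
  ∀ e ∈ atlas F M, ∀ e' ∈ atlas F M, IsKellerC1On (e' ∘ e.symm) (e.symm.trans e').source

/-- The tangent space `T_x M`. A tangent vector at `x` is represented, as for Mathlib's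
`TangentSpace`, by its coordinates in the preferred chart `chartAt F x`. -/
def TangentSp (_x : M) : Type _ := F

instance (x : M) : AddCommGroup (TangentSp F x) := inferInstanceAs (AddCommGroup F)
instance (x : M) : Module ℝ (TangentSp F x) := inferInstanceAs (Module ℝ F)

/-- The tangent vector at `e.symm y` whose coordinates in the chart `e` are `v`, for `y` in the
target of `e`: its coordinates in the preferred chart are the derivative of the transition
map applied to `v`. -/
def tangentOfCoord (e : OpenPartialHomeomorph M F) (p : e.target × F) :
    TotalSpace F (fun x : M => TangentSp F x) :=
  ⟨e.symm p.1,
    (dirDeriv (fun z : F => chartAt F (e.symm p.1) (e.symm z)) p.1 p.2 : F)⟩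

variable (M) in
/-- The tangent bundle `TM`. -/
abbrev TBundle : Type _ := TotalSpace F (fun x : M => TangentSp F x)

/-- The topology of the tangent bundle, glued from the products `e.target × F` over all charts
`e` of the atlas. -/
instance : TopologicalSpace (TBundle F M) :=
  ⨆ e ∈ atlas F M, TopologicalSpace.coinduced (tangentOfCoord F e) inferInstance

end Manifold

/-! ### Finsler structures -/

section Finsler

variable {F : Type*} [AddCommGroup F] [Module ℝ F] [TopologicalSpace F]

/-- A Finsler structure on the trivial bundle `T × F`. -/
structure IsTrivialFinsler {T : Type*} [TopologicalSpace T]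
    (p : ℕ → T → Seminorm ℝ F) : Prop where
  continuous : ∀ n, Continuous fun z : T × F => p n z.1 z.2
  withSeminorms : ∀ b : T, WithSeminorms (fun n => p n b)
  comparable : ∀ k : ℝ, 1 < k → ∀ b₀ : T, ∃ W ∈ 𝓝 b₀, ∀ w ∈ W, ∀ n : ℕ, ∀ v : F,
    (1 / k) * p n b₀ v ≤ p n w v ∧ p n w v ≤ k * p n b₀ v

variable (F) (M : Type*) [TopologicalSpace M] [ChartedSpace F M]

/-- A graded Finsler structure on the tangent bundle of `M`: an increasing sequence of continuous
functions on `TM` which are seminorms on the fibres and which, near each point of `M`, form a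
Finsler structure on the trivial bundle through some bundle chart, i.e. some
local trivialization of `TM` that is linear on the fibres. -/
structure GradedFinsler where
  /-- the `n`-th seminorm on `T_x M` -/
  norm : ℕ → ∀ x : M, Seminorm ℝ (TangentSp F x)
  continuous_norm : ∀ n, Continuous fun v : TBundle F M => norm n v.1 v.2
  graded : ∀ n (x : M) (v : TangentSp F x), norm n x v ≤ norm (n + 1) x v
  locally_finsler : ∀ x : M,
    ∃ (ψ : Trivialization F (π F (fun x : M => TangentSp F x))) (_ : ψ.IsLinear ℝ),
      x ∈ ψ.baseSet ∧
      IsTrivialFinsler fun n (b : ψ.baseSet) => (norm n b).comp (ψ.symmₗ ℝ (b : M))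

variable {F M}

/-- `v` is the velocity at time `t` of the curve `γ`, defined on the set `s` of times
(one-sided at the end points of an interval). -/
def HasVelocity (γ : ℝ → M) (s : Set ℝ) (t : ℝ) (v : TangentSp F (γ t)) : Prop :=
  Tendsto (fun r : ℝ => (r - t)⁻¹ • (chartAt F (γ t) (γ r) - chartAt F (γ t) (γ t)))
    (𝓝[s \ {t}] t) (𝓝 (show F from v))

/-- `γ` is a `C¹` curve on `[a, b]` with velocity field `v`. -/
structure IsC1Curve (γ : ℝ → M) (v : ∀ t, TangentSp F (γ t)) (a b : ℝ) : Prop where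
  lt : a < b
  continuousOn : ContinuousOn γ (Icc a b)
  hasVelocity : ∀ t ∈ Icc a b, HasVelocity γ (Icc a b) t (v t)
  continuousOn_velocity :
    ContinuousOn (fun t => (⟨γ t, v t⟩ : TBundle F M)) (Icc a b)

namespace GradedFinsler

variable (N : GradedFinsler F M)

/-- The length with respect to the `n`-th component of a `C¹` curve with velocity field `v`. -/
def length (n : ℕ) (γ : ℝ → M) (v : ∀ t, TangentSp F (γ t)) (a b : ℝ) : ℝ :=
  ∫ t in a..b, N.norm n (γ t) (v t)

/-- `N.IsPathLength n x y L`: some piecewise `C¹` path, i.e. some finite concatenation of `C¹`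
curves, joins `x` to `y` and has length `L` with respect to the `n`-th component. -/
inductive IsPathLength (n : ℕ) : M → M → ℝ → Prop
  | nil (x : M) : IsPathLength n x x 0
  | cons {γ : ℝ → M} {v : ∀ t, TangentSp F (γ t)} {a b : ℝ} {z : M} {L : ℝ}
      (hγ : IsC1Curve γ v a b) (hL : IsPathLength n (γ b) z L) :
      IsPathLength n (γ a) z (N.length n γ v a b + L)

/-- The distance `ρ_n`: the infimum of the lengths of the piecewise `C¹` paths from `x` to `y`. -/
def distN (n : ℕ) (x y : M) : ℝ := sInf {L : ℝ | N.IsPathLength n x y L}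

/-- The Finsler metric `ρ` (components numbered from `0`, so that the weights
`1/2, 1/4, …` are `(1/2)^(n+1)`). -/
def rho (x y : M) : ℝ :=
  ∑' n : ℕ, (1 / 2 : ℝ) ^ (n + 1) * (N.distN n x y / (1 + N.distN n x y))

/-- The Finsler metric `ρ` is complete. -/
def IsCompleteMetric : Prop :=
  ∀ u : ℕ → M, (∀ ε > 0, ∃ n₀, ∀ m ≥ n₀, ∀ n ≥ n₀, N.rho (u m) (u n) < ε) →
    ∃ x : M, Tendsto (fun n => N.rho (u n) x) atTop (𝓝 0)

end GradedFinsler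

end Finsler

/-! ### Functionals -/

section Functional

variable (F : Type*) [AddCommGroup F] [Module ℝ F] [TopologicalSpace F]
  {M : Type*} [TopologicalSpace M] [ChartedSpace F M]

/-- `φ : M → ℝ` is a (Keller) `C¹` functional: it is so in every chart. -/
def IsC1Functional (φ : M → ℝ) : Prop :=
  ∀ e ∈ atlas F M, IsKellerC1On (φ ∘ e.symm) e.target

/-- `x` is a critical point of `φ`: in a chart at `x`, all the directional derivatives of `φ`
exist and vanish. -/
def IsCriticalPoint (φ : M → ℝ) (x : M) : Prop :=
  ∃ e ∈ atlas F M, x ∈ e.source ∧ ∀ h : F, HasDirDeriv (φ ∘ e.symm) (e x) h 0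

variable {F}

/-- The derivative `φ'(x, h)` of `φ` at `x` in the direction of the tangent vector `h`. -/
def tangentDeriv (φ : M → ℝ) (x : M) (h : TangentSp F x) : ℝ :=
  dirDeriv (φ ∘ (chartAt F x).symm) (chartAt F x x) (show F from h)

namespace GradedFinsler

variable (N : GradedFinsler F M)

/-- The set `B_∞(0_x)` of the tangent vectors all of whose seminorms are at most `1`. -/
def unitBall (x : M) : Set (TangentSp F x) := {h | ∀ n, N.norm n x h ≤ 1}

/-- The auxiliary function `Φ_φ(x) = inf {φ'(x, h) : h ∈ B_∞(0_x)}`. (The set `B_∞(0_x)` contains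
`0` and is bounded in `T_x M`, so that this is the infimum of a non-empty bounded set of reals
when `φ` is a `C¹` functional.) -/
def auxPhi (φ : M → ℝ) (x : M) : ℝ := sInf (tangentDeriv φ x '' N.unitBall x)

/-- The Palais–Smale condition for `φ` at the level `c` in the set `A`. -/
def PalaisSmale (φ : M → ℝ) (c : ℝ) (A : Set M) : Prop :=
  ∀ m : ℕ → M, (∀ i, m i ∈ A) → Tendsto (fun i => φ (m i)) atTop (𝓝 c) →
    Tendsto (fun i => N.auxPhi φ (m i)) atTop (𝓝 0) →
    ∃ (x : M) (σ : ℕ → ℕ), StrictMono σ ∧ Tendsto (m ∘ σ) atTop (𝓝 x)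

end GradedFinsler

end Functional

end FrechetCrit

end

/-! The proof uses the closedness of `φ` in place of the Palais–Smale condition: all but countably
many levels of a closed map are compact, so that a point which is not critical forces the model
space to be locally compact, and a topological mountain pass argument, comparing connected
components of sublevel sets, gives a critical point on a level above those of the two minima. -/

namespace FrechetCrit

/-! ### Closed maps to the real line -/

section ClosedMap

variable {X : Type*} [TopologicalSpace X] [T1Space X] {φ : X → ℝ}

/-! Suppose that there is no third critical point, and let `x₀` be the minimum with the larger
value. Connectedness provides a point other than `x₀` and `x₁`, hence not critical. Near it `φ`
decreases strictly along a direction `h` and takes a whole interval of values, so one of these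
levels is compact by `countable_setOf_not_isCompact_level`. Every point near this level is reached
from it by a short translation along `h`, so `F`, and with it `M`, is locally compact
(`IsC1Functional.locallyCompactSpace_model`).

Now `x₀` is a strict local minimum, since a nearby point of equal value would be a third local
minimum. By compactness `φ ≥ b > φ x₀` on the boundary of a small neighbourhood
(`exists_rim_of_strict_local_min`). Let `c ≥ b` be the infimum of the levels `a` for which `x₀` and
`x₁` lie in one component of `{φ < a}`. Near a noncritical point of level `c`, the set `{φ < c}` is
connected and accumulates at the point, so two components of it cannot touch there. If all points of
level `c` are noncritical, closedness of `φ` keeps the components apart slightly above `c`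
(`exists_separation_of_sublevel`), against the choice of `c`. No gradient flow is needed. -/

/-- For a closed map, a sequence of points off a level whose values tend to that level cannot
eventually leave every member of an increasing open cover of the level. -/
theorem exists_nearby_levels_subset (hc : Continuous φ) (hcl : IsClosedMap φ) {c : ℝ}
    {O : ℕ → Set X} (hO : ∀ j, IsOpen (O j)) (hmono : Monotone O)
    (hcov : φ ⁻¹' {c} ⊆ ⋃ j, O j) :
    ∃ j : ℕ, ∀ z, φ z ≠ c → |φ z - c| < 1 / ((j : ℝ) + 1) → z ∈ O j := by
  by_contra! H
  choose z hzne hz hzO using H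
  have hlim : Tendsto (fun j => φ (z j)) atTop (𝓝 c) := by
    rw [tendsto_iff_dist_tendsto_zero]
    exact squeeze_zero (fun _ => dist_nonneg) (fun j => (hz j).le)
      tendsto_one_div_add_atTop_nhds_zero_nat
  -- On the level, a neighbourhood `O i` contains no `z j` with `j ≥ i`; off the level, the values
  -- `φ (z j) → c` are eventually separated from `φ x`. Local finiteness makes the set of all `z j`
  -- closed, so its image must contain the limit `c`.
  have hlf : LocallyFinite fun j => ({z j} : Set X) := by
    intro x
    by_cases hx : φ x = c
    · obtain ⟨i, hi⟩ := mem_iUnion.1 (hcov (show x ∈ φ ⁻¹' {c} from hx))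
      refine ⟨O i, (hO i).mem_nhds hi, (finite_lt_nat i).subset ?_⟩
      rintro j ⟨y, rfl, hy⟩
      by_contra hij
      exact hzO j (hmono (not_lt.1 hij) hy)
    · obtain ⟨u, v, hu, hv, hxu, hcv, huv⟩ := t2_separation hx
      refine ⟨φ ⁻¹' u, (hu.preimage hc).mem_nhds hxu, ?_⟩
      have hev : ∀ᶠ j in atTop, φ (z j) ∈ v := hlim (hv.mem_nhds hcv)
      obtain ⟨i, hi⟩ := eventually_atTop.1 hev
      refine (finite_lt_nat i).subset ?_
      rintro j ⟨y, rfl, hy⟩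
      by_contra hij
      exact disjoint_left.1 huv hy (hi j (not_lt.1 hij))
  have hclosed := hcl _ (hlf.isClosed_iUnion fun _ => isClosed_singleton)
  have hmem : c ∈ φ '' ⋃ j, {z j} :=
    hclosed.mem_of_tendsto hlim (Eventually.of_forall fun j =>
      mem_image_of_mem _ (mem_iUnion.2 ⟨j, rfl⟩))
  obtain ⟨y, hy, hyc⟩ := hmem
  obtain ⟨j, rfl⟩ := mem_iUnion.1 hy
  exact hzne j hyc

/-- All but countably many level sets of a continuous closed real function on a second countable
space are compact. -/
theorem countable_setOf_not_isCompact_level [SecondCountableTopology X]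
    (hc : Continuous φ) (hcl : IsClosedMap φ) :
    {c : ℝ | ¬ IsCompact (φ ⁻¹' {c})}.Countable := by
  -- Adjoining `∅` makes the family nonempty, as an enumeration by `ℕ` requires.
  obtain ⟨e, he⟩ : ∃ e : ℕ → Set X, insert ∅ (TopologicalSpace.countableBasis X) = range e :=
    ((TopologicalSpace.countable_countableBasis X).insert ∅).exists_eq_range
      (insert_nonempty _ _)
  have heo : ∀ i, IsOpen (e i) := by
    intro i
    have : e i ∈ insert ∅ (TopologicalSpace.countableBasis X) := he ▸ mem_range_self i
    rcases this with h | h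
    · rw [h]; exact isOpen_empty
    · exact TopologicalSpace.isOpen_of_mem_countableBasis h
  -- Distinct members of one `E q` are at least `1 / (q.2 + 1)` apart: otherwise the finite union
  -- would cover a level which it is required not to cover. So the floor map below is injective on
  -- `E q`.
  let E : Finset ℕ × ℕ → Set ℝ := fun q =>
    {c | ¬ φ ⁻¹' {c} ⊆ (⋃ i ∈ q.1, e i) ∧
      ∀ z, φ z ≠ c → |φ z - c| < 1 / ((q.2 : ℝ) + 1) → z ∈ ⋃ i ∈ q.1, e i}
  have hE : ∀ q, (E q).Countable := by
    intro q
    have hpos : (0 : ℝ) < (q.2 : ℝ) + 1 := by positivity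
    refine MapsTo.countable_of_injOn (f := fun c : ℝ => ⌊c * ((q.2 : ℝ) + 1)⌋) (t := univ)
      (fun _ _ => mem_univ _) ?_ (to_countable _)
    intro c hcE c' hcE' heq
    by_contra hne
    refine hcE.1 fun z hz => ?_
    have hz' : φ z = c := hz
    refine hcE'.2 z (by rw [hz']; exact hne) ?_
    have := Int.abs_sub_lt_one_of_floor_eq_floor heq
    rw [← sub_mul, abs_mul, abs_of_pos hpos] at this
    rwa [hz', lt_div_iff₀ hpos]
  refine (countable_iUnion hE).mono fun c hcK => ?_
  have hncov : ∃ (ι : Type _) (U : ι → Set X), (∀ i, IsOpen (U i)) ∧ φ ⁻¹' {c} ⊆ ⋃ i, U i ∧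
      ∀ t : Finset ι, ¬ φ ⁻¹' {c} ⊆ ⋃ i ∈ t, U i := by
    by_contra! H
    exact hcK (isCompact_of_finite_subcover fun {ι} U hU hcov => H ι U hU hcov)
  obtain ⟨ι, U, hUo, hUcov, hUfin⟩ := hncov
  classical
  -- The basic sets contained in some `U k`, truncated at index `j`, form an increasing open cover
  -- of the level. No truncation covers it, since finitely many `U k` would then do so; this puts
  -- `c` in `E (t j, j)`.
  let t : ℕ → Finset ℕ := fun j => (Finset.range j).filter fun i => ∃ k, e i ⊆ U k
  have htm : Monotone fun j => ⋃ i ∈ t j, e i := by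
    intro j j' hjj
    have hsub : t j ⊆ t j' := Finset.filter_subset_filter _ (Finset.range_mono hjj)
    exact biUnion_subset_biUnion_left fun i hi => hsub hi
  have htcov : φ ⁻¹' {c} ⊆ ⋃ j, ⋃ i ∈ t j, e i := by
    intro x hx
    obtain ⟨k, hk⟩ := mem_iUnion.1 (hUcov hx)
    obtain ⟨b, hb, hxb, hbU⟩ := (TopologicalSpace.isBasis_countableBasis X).exists_subset_of_mem_open
      hk (hUo k)
    obtain ⟨i, rfl⟩ : b ∈ range e := he ▸ mem_insert_of_mem _ hb
    refine mem_iUnion.2 ⟨i + 1, mem_iUnion₂.2 ⟨i, ?_, hxb⟩⟩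
    simp only [t, Finset.mem_filter, Finset.mem_range]
    exact ⟨Nat.lt_succ_self i, k, hbU⟩
  obtain ⟨j, hj⟩ := exists_nearby_levels_subset hc hcl
    (fun j => isOpen_biUnion fun i _ => heo i) htm htcov
  refine mem_iUnion.2 ⟨(t j, j), fun hsub => ?_, hj⟩
  have hk : ∀ i ∈ t j, ∃ k, e i ⊆ U k := fun i hi => (Finset.mem_filter.1 hi).2
  choose k hk using hk
  refine hUfin ((t j).attach.image fun i => k i.1 i.2) (hsub.trans ?_)
  refine iUnion₂_subset fun i hi => (hk i hi).trans ?_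
  exact subset_biUnion_of_mem (u := U)
    (Finset.mem_coe.2 (Finset.mem_image_of_mem _ (Finset.mem_attach _ ⟨i, hi⟩)))

end ClosedMap

/-! ### A topological mountain pass -/

section MountainPass

variable {X : Type*} [TopologicalSpace X] {φ : X → ℝ}

/-- If near every point of level `c` the sublevel set `{φ < c}` is connected and accumulates at
the point, then a connected component of `{φ < c}` is separated from the remaining points of
`{φ < c}` in some larger sublevel set. -/
theorem exists_separation_of_sublevel [NormalSpace X] [LocallyConnectedSpace X]
    (hc : Continuous φ) (hcl : IsClosedMap φ) {c : ℝ} {x : X}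
    (hloc : ∀ p, φ p = c → p ∈ closure {z | φ z < c} ∧
      ∃ W, IsOpen W ∧ p ∈ W ∧ IsPreconnected (W ∩ {z | φ z < c})) :
    ∃ U V : Set X, IsOpen U ∧ IsOpen V ∧ Disjoint U V ∧
      connectedComponentIn {z | φ z < c} x ⊆ U ∧
      {z | φ z < c} \ connectedComponentIn {z | φ z < c} x ⊆ V ∧
      ∃ a > c, {z | φ z < a} ⊆ U ∪ V := by
  set A := connectedComponentIn {z | φ z < c} x with hA
  have hSo : IsOpen {z | φ z < c} := isOpen_lt hc continuous_const
  have hAo : IsOpen A := hSo.connectedComponentIn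
  have hAS : A ⊆ {z | φ z < c} := connectedComponentIn_subset _ _
  have hAle : ∀ z ∈ closure A, φ z ≤ c := fun z hz =>
    closure_minimal (fun y hy => (hAS hy).le) (isClosed_le hc continuous_const) hz
  have hpre : ∀ s : Set X, IsPreconnected s → s ⊆ {z | φ z < c} → (s ∩ A).Nonempty → s ⊆ A := by
    rintro s hs hsS ⟨y, hys, hyA⟩
    rw [hA, connectedComponentIn_eq hyA]
    exact hs.subset_connectedComponentIn hys hsS
  have hAcl : ∀ z ∈ closure A, φ z < c → z ∈ A := by
    intro z hz hzc
    have hzo : IsOpen (connectedComponentIn {z | φ z < c} z) := hSo.connectedComponentIn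
    have hzz : z ∈ connectedComponentIn {z | φ z < c} z := mem_connectedComponentIn hzc
    exact hpre _ isPreconnected_connectedComponentIn (connectedComponentIn_subset _ _)
      (mem_closure_iff.1 hz _ hzo hzz) hzz
  -- `G` serves to show that `closure A` is relatively open in `{φ ≤ c}`, so that `{φ ≤ c}` splits
  -- into two disjoint closed pieces.
  let G : Set X := ⋃₀ {O | IsOpen O ∧ O ∩ {z | φ z ≤ c} ⊆ closure A}
  have hGo : IsOpen G := isOpen_sUnion fun O hO => hO.1
  have hGA : closure A ⊆ G := by
    intro p hp
    rcases (hAle p hp).lt_or_eq with h | h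
    · exact ⟨A, ⟨hAo, inter_subset_left.trans subset_closure⟩, hAcl p hp h⟩
    · obtain ⟨-, W, hWo, hpW, hWc⟩ := hloc p h
      have hWA : W ∩ {z | φ z < c} ⊆ A := by
        refine hpre _ hWc inter_subset_right ?_
        obtain ⟨y, hyW, hyA⟩ := mem_closure_iff.1 hp W hWo hpW
        exact ⟨y, ⟨hyW, hAS hyA⟩, hyA⟩
      refine ⟨W, ⟨hWo, ?_⟩, hpW⟩
      rintro q ⟨hqW, hqc⟩
      rcases (show φ q ≤ c from hqc).lt_or_eq with h' | h'
      · exact subset_closure (hWA ⟨hqW, h'⟩)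
      · exact closure_mono hWA (hWo.inter_closure ⟨hqW, (hloc q h').1⟩)
  have hGsub : G ∩ {z | φ z ≤ c} ⊆ closure A := by
    rintro z ⟨⟨O, hO, hzO⟩, hz⟩
    exact hO.2 ⟨hzO, hz⟩
  have hBcl : IsClosed ({z | φ z ≤ c} \ G) :=
    (isClosed_le hc continuous_const).sdiff hGo
  have hdisj : Disjoint (closure A) ({z | φ z ≤ c} \ G) :=
    disjoint_left.2 fun z hz hz' => hz'.2 (hGA hz)
  obtain ⟨U, V, hU, hV, hAU, hBV, hUV⟩ := normal_separation isClosed_closure hBcl hdisj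
  refine ⟨U, V, hU, hV, hUV, subset_closure.trans hAU, ?_, ?_⟩
  · rintro z ⟨hz, hzA⟩
    have hz' : φ z < c := hz
    exact hBV ⟨hz'.le, fun hzG => hzA (hAcl z (hGsub ⟨hzG, hz'.le⟩) hz')⟩
  -- The closed set `(U ∪ V)ᶜ` misses `{φ ≤ c}`, so its closed image misses a ball around `c`: this
  -- yields the margin `ε` above the level.
  · have hZ : IsClosed (φ '' (U ∪ V)ᶜ) := hcl _ (hU.union hV).isClosed_compl
    have hle : {z | φ z ≤ c} ⊆ U ∪ V := by
      intro z hz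
      by_cases hzG : z ∈ G
      · exact Or.inl (hAU (hGsub ⟨hzG, hz⟩))
      · exact Or.inr (hBV ⟨hz, hzG⟩)
    have hcn : c ∈ (φ '' (U ∪ V)ᶜ)ᶜ := by
      rintro ⟨z, hz, hzc⟩
      exact hz (hle hzc.le)
    obtain ⟨ε, hε, hball⟩ := Metric.isOpen_iff.1 hZ.isOpen_compl c hcn
    refine ⟨c + ε, by linarith, fun z hz => ?_⟩
    by_contra hzUV
    have hcz : c < φ z := by
      by_contra h
      exact hzUV (hle (not_lt.1 h))
    have hz' : φ z < c + ε := hz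
    refine hball (show φ z ∈ Metric.ball c ε from ?_) (mem_image_of_mem φ hzUV)
    rw [Metric.mem_ball, Real.dist_eq, abs_lt]
    constructor <;> linarith

/-- **Mountain pass**, topological form: if every connected set joining `x` to `y` meets
`{φ ≥ b}`, where `b` exceeds the values at the end points, then on some level at least `b` there
is a point near which the sublevel set is not a connected set accumulating at the point. -/
theorem exists_mountain_pass_point [NormalSpace X] [LocallyPathConnectedSpace X] [ConnectedSpace X]
    (hc : Continuous φ) (hcl : IsClosedMap φ) {b : ℝ} {x y : X}
    (hx : φ x < b) (hy : φ y < b)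
    (hb : ∀ a, y ∈ connectedComponentIn {z | φ z < a} x → b ≤ a) :
    ∃ p, b ≤ φ p ∧ ¬ (p ∈ closure {z | φ z < φ p} ∧
      ∃ W, IsOpen W ∧ p ∈ W ∧ IsPreconnected (W ∩ {z | φ z < φ p})) := by
  have : PathConnectedSpace X := pathConnectedSpace_iff_connectedSpace.2 inferInstance
  set S : Set ℝ := {a | y ∈ connectedComponentIn {z | φ z < a} x}
  have hpath : ∀ (s : Set X), JoinedIn s x y → ∃ z ∈ s, ∀ a, φ z < a → a ∈ S := by
    rintro s ⟨γ, hγ⟩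
    obtain ⟨z, hz, hmax⟩ := (isCompact_range γ.continuous).exists_isMaxOn (range_nonempty γ)
      hc.continuousOn
    obtain ⟨t, rfl⟩ := hz
    refine ⟨γ t, hγ t, fun a ha => ?_⟩
    exact (isPreconnected_range γ.continuous).subset_connectedComponentIn
      ⟨0, γ.source⟩ (fun w hw => (show φ w ≤ φ (γ t) from hmax hw).trans_lt ha) ⟨1, γ.target⟩
  have hSne : S.Nonempty := by
    obtain ⟨z, -, hz⟩ := hpath univ (joinedIn_univ.2 (PathConnectedSpace.joined x y))
    exact ⟨φ z + 1, hz _ (by linarith)⟩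
  have hSb : BddBelow S := ⟨b, fun a ha => hb a ha⟩
  -- The minimax level of the mountain pass.
  set c := sInf S
  have hbc : b ≤ c := le_csInf hSne fun a ha => hb a ha
  by_contra! H
  obtain ⟨U, V, hU, hV, hUV, hAU, hBV, a, hac, haUV⟩ :=
    exists_separation_of_sublevel (c := c) (x := x) hc hcl (fun p hp => by
      rw [← hp] at hbc ⊢
      exact H p hbc)
  have hSo : IsOpen {z | φ z < c} := isOpen_lt hc continuous_const
  have hxA : x ∈ connectedComponentIn {z | φ z < c} x :=
    mem_connectedComponentIn (show φ x < c by linarith)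
  -- Otherwise a path inside the open set `{φ < c}` would have a maximum strictly below `c`,
  -- producing a member of `S` smaller than its infimum.
  have hyA : y ∉ connectedComponentIn {z | φ z < c} x := by
    intro hyA
    have hP : IsPathConnected (connectedComponentIn {z | φ z < c} x) :=
      (hSo.connectedComponentIn.isConnected_iff_isPathConnected).1
        ⟨⟨x, hxA⟩, isPreconnected_connectedComponentIn⟩
    obtain ⟨z, hz, hzS⟩ := hpath _ (hP.joinedIn x hxA y hyA)
    have hzc : z ∈ {z | φ z < c} := connectedComponentIn_subset _ _ hz
    obtain ⟨d, hd1, hd2⟩ := exists_between (show φ z < c from hzc)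
    exact absurd (csInf_le hSb (hzS d hd1)) (not_le.2 hd2)
  obtain ⟨a', ha', ha'a⟩ := exists_lt_of_csInf_lt hSne (show sInf S < a from hac)
  have hsub : connectedComponentIn {z | φ z < a'} x ⊆ U := by
    refine isPreconnected_connectedComponentIn.subset_left_of_subset_union hU hV hUV ?_ ?_
    · exact (connectedComponentIn_subset _ _).trans
        (Subset.trans (fun z hz => lt_trans hz ha'a) haUV)
    · refine ⟨x, mem_connectedComponentIn ?_, hAU hxA⟩
      have := hb a' ha'
      exact hx.trans_le this
  exact disjoint_left.1 hUV (hsub ha') (hBV ⟨show φ y < c by linarith, hyA⟩)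

/-- At a strict local minimum `x` in a locally compact space there is a rim `b > φ x` such that
the component of `x` in each sublevel set `{φ < a}`, `a < b`, stays in a given neighbourhood. -/
theorem exists_rim_of_strict_local_min [T2Space X] [LocallyCompactSpace X] [ConnectedSpace X]
    (hc : Continuous φ) {x y : X} {V : Set X} (hV : V ∈ 𝓝 x) (hy : y ∉ V)
    (hmin : ∀ z ∈ V, z ≠ x → φ x < φ z) :
    ∃ b, φ x < b ∧ ∀ a, y ∈ connectedComponentIn {z | φ z < a} x → b ≤ a := by
  obtain ⟨K, hK, hKV, hKc⟩ := local_compact_nhds hV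
  have hfr : frontier K ⊆ K := hKc.isClosed.frontier_subset
  have hxfr : x ∉ frontier K := fun h => h.2 (mem_interior_iff_mem_nhds.2 hK)
  have hfc : IsCompact (frontier K) := hKc.of_isClosed_subset isClosed_frontier hfr
  have hne : (frontier K).Nonempty := nonempty_frontier_iff.2
    ⟨⟨x, mem_of_mem_nhds hK⟩, fun h => hy (hKV (h ▸ mem_univ y))⟩
  -- The rim height is the minimum of `φ` on `frontier K`; a component below that height cannot
  -- cross the frontier.
  obtain ⟨m, hm, hmmin⟩ := hfc.exists_isMinOn hne hc.continuousOn
  refine ⟨φ m, hmin m (hKV (hfr hm)) (fun h => hxfr (h ▸ hm)), fun a ha => ?_⟩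
  by_contra! hlt
  have hxa : x ∈ connectedComponentIn {z | φ z < a} x := by
    by_contra hx
    rw [connectedComponentIn_eq_empty (fun h => hx (mem_connectedComponentIn h))] at ha
    exact ha
  have hsub : connectedComponentIn {z | φ z < a} x ⊆ interior K := by
    refine isPreconnected_connectedComponentIn.subset_left_of_subset_union isOpen_interior
      hKc.isClosed.isOpen_compl (disjoint_left.2 fun z hz hz' => hz' (interior_subset hz)) ?_
      ⟨x, hxa, mem_interior_iff_mem_nhds.2 hK⟩
    intro z hz
    by_cases hzK : z ∈ K
    · by_cases hzi : z ∈ interior K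
      · exact Or.inl hzi
      · have h1 : φ m ≤ φ z := hmmin ⟨subset_closure hzK, hzi⟩
        have h2 : z ∈ {z | φ z < a} := connectedComponentIn_subset _ _ hz
        exact absurd (hlt.trans_le h1) (not_lt.2 h2.le)
    · exact Or.inr hzK
  exact hy (hKV (interior_subset (hsub ha)))

end MountainPass

/-! ### Functions decreasing in a direction on a locally convex space -/

section Descent

variable {E : Type*} [AddCommGroup E] [Module ℝ E]

/-- The directional derivatives along a line are the derivatives of the restriction. -/
theorem HasDirDeriv.hasDerivAt {f : E → ℝ} {x h : E} {t d : ℝ}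
    (hf : HasDirDeriv f (x + t • h) h d) : HasDerivAt (fun s : ℝ => f (x + s • h)) d t := by
  rw [hasDerivAt_iff_tendsto_slope_zero]
  refine Tendsto.congr (fun s => ?_) hf
  rw [add_assoc, ← add_smul]

theorem strictAntiOn_of_hasDirDeriv_neg {f g : E → ℝ} {U : Set E} {x h : E} {D : Set ℝ}
    (hD : Convex ℝ D) (hU : ∀ t ∈ D, x + t • h ∈ U)
    (hf : ∀ z ∈ U, HasDirDeriv f z h (g z)) (hg : ∀ z ∈ U, g z < 0) :
    StrictAntiOn (fun t : ℝ => f (x + t • h)) D := by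
  refine strictAntiOn_of_deriv_neg hD (fun t ht => ?_) fun t ht => ?_
  · exact (hf _ (hU t ht)).hasDerivAt.continuousAt.continuousWithinAt
  · have := interior_subset ht
    rw [(hf _ (hU t this)).hasDerivAt.deriv]
    exact hg _ (hU t this)

variable [TopologicalSpace E]

/-- A directional derivative at a local minimum vanishes. -/
theorem HasDirDeriv.eq_zero_of_isLocalMin [ContinuousAdd E] [ContinuousSMul ℝ E]
    {f : E → ℝ} {x h : E} {d : ℝ} (hf : HasDirDeriv f x h d) (hx : IsLocalMin f x) : d = 0 := by
  have hd : HasDerivAt (fun s : ℝ => f (x + s • h)) d 0 :=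
    HasDirDeriv.hasDerivAt (by rwa [zero_smul, add_zero])
  have hcont : Tendsto (fun s : ℝ => x + s • h) (𝓝 0) (𝓝 x) := by
    have : Continuous fun s : ℝ => x + s • h := by fun_prop
    simpa using this.tendsto 0
  have hmin : IsLocalMin (fun s : ℝ => f (x + s • h)) 0 := by
    filter_upwards [hcont.eventually hx] with s hs
    simpa using hs
  exact hmin.hasDerivAt_eq_zero hd

variable [IsTopologicalAddGroup E] [ContinuousSMul ℝ E]

/-- Every neighbourhood of `x` contains a neighbourhood of the form
`x + V + [-t₀, t₀] h`, with `V` a neighbourhood of `0`. -/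
theorem exists_smul_add_subset {U : Set E} {x : E} (hU : U ∈ 𝓝 x) (h : E) :
    ∃ t₀ > 0, ∃ V ∈ 𝓝 (0 : E), ∀ t : ℝ, |t| ≤ t₀ → ∀ v ∈ V, x + v + t • h ∈ U := by
  have hc : Tendsto (fun q : ℝ × E => x + q.2 + q.1 • h) (𝓝 (0, 0)) (𝓝 x) := by
    have : Continuous fun q : ℝ × E => x + q.2 + q.1 • h := by fun_prop
    simpa using this.tendsto (0, 0)
  have hmem := hc hU
  rw [mem_map, nhds_prod_eq] at hmem
  obtain ⟨T, hT, V, hV, hTV⟩ := mem_prod_iff.1 hmem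
  obtain ⟨r, hr, hrT⟩ := Metric.mem_nhds_iff.1 hT
  refine ⟨r / 2, by positivity, V, hV, fun t ht v hv => ?_⟩
  have : t ∈ T := hrT (by rw [mem_ball_zero_iff, Real.norm_eq_abs]; linarith)
  exact @hTV (t, v) ⟨this, hv⟩

/-- Near a point where a function decreases strictly in some direction, its strict sublevel set is
connected and accumulates at the point. -/
theorem exists_isPreconnected_sublevel [LocallyConvexSpace ℝ E] {f g : E → ℝ} {U : Set E} {x h : E} (hU : U ∈ 𝓝 x)
    (hfc : ContinuousOn f U)
    (hf : ∀ z ∈ U, HasDirDeriv f z h (g z)) (hg : ∀ z ∈ U, g z < 0) :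
    ∃ W, IsOpen W ∧ x ∈ W ∧ W ⊆ U ∧ IsPreconnected (W ∩ {z | f z < f x}) ∧
      x ∈ closure (W ∩ {z | f z < f x}) := by
  obtain ⟨t₀, ht₀, V₁, hV₁, hsub⟩ := exists_smul_add_subset hU h
  have hanti : ∀ v ∈ V₁, StrictAntiOn (fun t : ℝ => f (x + v + t • h)) (Icc (-t₀) t₀) :=
    fun v hv => strictAntiOn_of_hasDirDeriv_neg (convex_Icc _ _)
      (fun t ht => hsub t (abs_le.2 ht) v hv) hf hg
  have h0 : (0 : E) ∈ V₁ := mem_of_mem_nhds hV₁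
  have hend : f (x + t₀ • h) < f x := by
    have := hanti 0 h0 (a := 0) (b := t₀) ⟨by linarith, ht₀.le⟩ ⟨by linarith, le_rfl⟩ ht₀
    simpa using this
  have hUo : ∃ V₂ ∈ 𝓝 (0 : E), ∀ v ∈ V₂, f (x + v + t₀ • h) < f x := by
    have hmem : U ∈ 𝓝 (x + t₀ • h) := by
      have : (fun y => -(x + t₀ • h) + y) ⁻¹' V₁ ∈ 𝓝 (x + t₀ • h) := by
        refine ContinuousAt.preimage_mem_nhds (by fun_prop) ?_
        simpa using hV₁
      filter_upwards [this] with y hy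
      have := hsub t₀ (abs_of_pos ht₀).le _ hy
      rwa [show x + (-(x + t₀ • h) + y) + t₀ • h = y by abel] at this
    have hca : ContinuousAt f (x + t₀ • h) := hfc.continuousAt hmem
    have ht : Tendsto (fun v : E => x + v + t₀ • h) (𝓝 0) (𝓝 (x + t₀ • h)) := by
      have : Continuous fun v : E => x + v + t₀ • h := by fun_prop
      simpa using this.tendsto 0
    exact ⟨_, ht.eventually (hca.eventually_lt continuousAt_const hend), fun v hv => hv⟩
  obtain ⟨V₂, hV₂, hlt⟩ := hUo
  obtain ⟨V, ⟨h0V, hVo, hVc⟩, hV12⟩ :=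
    (LocallyConvexSpace.convex_open_basis_zero ℝ E).mem_iff.1 (inter_mem hV₁ hV₂)
  have hVsub : ∀ v ∈ V, v ∈ V₁ := fun v hv => (hV12 hv).1
  -- A cylinder over `V` running only forward along `h`, so that its far end `T` lies wholly in the
  -- sublevel set. Each point of the sublevel set slides down along `h` to `T`, which is connected
  -- as a translate of the convex set `V`.
  let W : Set E := ⋃ t ∈ Icc (0 : ℝ) t₀, (fun y => y - x - t • h) ⁻¹' V
  have hW : ∀ z, z ∈ W ↔ ∃ t ∈ Icc (0 : ℝ) t₀, ∃ v ∈ V, z = x + v + t • h := by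
    intro z
    simp only [W, mem_iUnion₂, mem_preimage, exists_prop]
    constructor
    · rintro ⟨t, ht, hv⟩
      exact ⟨t, ht, _, hv, by abel⟩
    · rintro ⟨t, ht, v, hv, rfl⟩
      refine ⟨t, ht, ?_⟩
      convert hv using 1
      abel
  have hWo : IsOpen W := isOpen_biUnion fun t _ => hVo.preimage (by fun_prop)
  have hxW : x ∈ W := (hW x).2 ⟨0, ⟨le_rfl, ht₀.le⟩, 0, h0V, by simp⟩
  refine ⟨W, hWo, hxW, ?_, ?_, ?_⟩
  · intro z hz
    obtain ⟨t, ht, v, hv, rfl⟩ := (hW z).1 hz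
    exact hsub t (abs_le.2 ⟨by linarith [ht.1], ht.2⟩) v (hVsub v hv)
  · let T : Set E := (fun v => x + v + t₀ • h) '' V
    have hT : IsPreconnected T := hVc.isPreconnected.image _ (by fun_prop)
    have hTsub : T ⊆ W ∩ {z | f z < f x} := by
      rintro _ ⟨v, hv, rfl⟩
      exact ⟨(hW _).2 ⟨t₀, ⟨ht₀.le, le_rfl⟩, v, hv, rfl⟩, hlt v (hV12 hv).2⟩
    refine isPreconnected_of_forall (x + 0 + t₀ • h) ?_
    rintro z ⟨hz, hzc⟩
    obtain ⟨t, ht, v, hv, rfl⟩ := (hW z).1 hz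
    let R : Set E := (fun s : ℝ => x + v + s • h) '' Icc t t₀
    have hR : IsPreconnected R := isPreconnected_Icc.image _ (by fun_prop)
    refine ⟨R ∪ T, union_subset ?_ hTsub, Or.inr ⟨0, h0V, rfl⟩, Or.inl ⟨t, ⟨le_rfl, ht.2⟩, rfl⟩, ?_⟩
    · rintro _ ⟨s, hs, rfl⟩
      refine ⟨(hW _).2 ⟨s, ⟨ht.1.trans hs.1, hs.2⟩, v, hv, rfl⟩, ?_⟩
      refine lt_of_le_of_lt ?_ (show f (x + v + t • h) < f x from hzc)
      exact (hanti v (hVsub v hv)).antitoneOn ⟨by linarith [ht.1], ht.2⟩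
        ⟨by linarith [ht.1, hs.1], hs.2⟩ hs.1
    · exact IsPreconnected.union (x + v + t₀ • h) ⟨t₀, ⟨ht.2, le_rfl⟩, rfl⟩ ⟨v, hv, rfl⟩ hR hT
  · have ht : Tendsto (fun t : ℝ => x + t • h) (𝓝[>] 0) (𝓝 x) := by
      have : Continuous fun t : ℝ => x + t • h := by fun_prop
      have := this.tendsto 0
      rw [zero_smul, add_zero] at this
      exact this.mono_left nhdsWithin_le_nhds
    refine mem_closure_of_tendsto ht ?_
    filter_upwards [Ioc_mem_nhdsGT ht₀] with t htt
    refine ⟨(hW _).2 ⟨t, ⟨htt.1.le, htt.2⟩, 0, h0V, by simp⟩, ?_⟩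
    have := hanti 0 h0 (a := 0) (b := t) ⟨by linarith, ht₀.le⟩ ⟨by linarith [htt.1], htt.2⟩ htt.1
    simpa using this

/-- If a function decreases strictly in some direction near a point `x` and the level set through
`x` has a compact trace near `x`, then the whole space is locally compact. -/
theorem locallyCompactSpace_of_isCompact_level {f g : E → ℝ} {U C : Set E} {x h : E}
    (hU : U ∈ 𝓝 x) (hfc : ContinuousOn f U)
    (hf : ∀ z ∈ U, HasDirDeriv f z h (g z)) (hg : ∀ z ∈ U, g z < 0)
    (hC : IsCompact C) (hUC : ∀ z ∈ U, f z = f x → z ∈ C) : LocallyCompactSpace E := by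
  obtain ⟨t₀, ht₀, V, hV, hsub⟩ := exists_smul_add_subset (interior_mem_nhds.2 hU) h
  have hanti : ∀ v ∈ V, StrictAntiOn (fun t : ℝ => f (x + v + t • h)) (Icc (-t₀) t₀) :=
    fun v hv => strictAntiOn_of_hasDirDeriv_neg (convex_Icc _ _)
      (fun t ht => interior_subset (hsub t (abs_le.2 ht) v hv)) hf hg
  have h0 : (0 : E) ∈ V := mem_of_mem_nhds hV
  have hr : f (x + t₀ • h) < f x := by
    have := hanti 0 h0 (a := 0) (b := t₀) ⟨by linarith, ht₀.le⟩ ⟨by linarith, le_rfl⟩ ht₀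
    simpa using this
  have hl : f x < f (x + (-t₀) • h) := by
    have := hanti 0 h0 (a := -t₀) (b := 0) ⟨le_rfl, by linarith⟩ ⟨by linarith, ht₀.le⟩
      (by linarith)
    simpa using this
  have hcont : ∀ t : ℝ, |t| ≤ t₀ → ContinuousAt (fun y => f (y + t • h)) x := by
    intro t ht
    have hm : x + t • h ∈ interior U := by simpa using hsub t ht 0 h0
    have : ContinuousAt f (x + t • h) := hfc.continuousAt (mem_interior_iff_mem_nhds.1 hm)
    exact ContinuousAt.comp' (f := fun y : E => y + t • h) this (by fun_prop)
  have e1 := (hcont t₀ (abs_of_pos ht₀).le).eventually_lt continuousAt_const hr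
  have e2 := continuousAt_const.eventually_lt
    (hcont (-t₀) (by rw [abs_neg, abs_of_pos ht₀])) hl
  have e3 : ∀ᶠ y in 𝓝 x, y - x ∈ V := by
    have : Tendsto (fun y => y - x) (𝓝 x) (𝓝 0) := by
      have : Continuous fun y : E => y - x := by fun_prop
      simpa using this.tendsto x
    exact this hV
  -- The segment through any `y` near `x` in the direction `h` crosses the level of `x` at a
  -- parameter `t ∈ [-t₀, t₀]`, so `y` is a point of `C` minus `t • h`. One compact neighbourhood
  -- suffices in a topological group.
  have hK : IsCompact ((fun q : E × ℝ => q.1 - q.2 • h) '' C ×ˢ Icc (-t₀) t₀) :=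
    (hC.prod isCompact_Icc).image (by fun_prop)
  refine hK.locallyCompactSpace_of_mem_nhds_of_addGroup (x := x) ?_
  filter_upwards [e1, e2, e3] with y hy1 hy2 hy3
  have hline : ∀ t ∈ Icc (-t₀) t₀, y + t • h ∈ interior U := by
    intro t ht
    have := hsub t (abs_le.2 ht) _ hy3
    rwa [add_sub_cancel] at this
  have hco : ContinuousOn (fun t : ℝ => f (y + t • h)) (Icc (-t₀) t₀) :=
    hfc.comp (by fun_prop) fun t ht => interior_subset (hline t ht)
  obtain ⟨t, ht, hft⟩ := intermediate_value_Icc' (by linarith) hco ⟨hy1.le, hy2.le⟩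
  exact ⟨(y + t • h, t), ⟨hUC _ (interior_subset (hline t ht)) hft, ht⟩, by simp⟩

end Descent

/-! ### `C¹` functionals on manifolds -/

section Functionals

variable {F : Type*} [AddCommGroup F] [Module ℝ F] [TopologicalSpace F]
  {M : Type*} [TopologicalSpace M] [ChartedSpace F M] {φ : M → ℝ}

theorem IsC1Functional.continuous (hφ : IsC1Functional F φ) : Continuous φ := by
  refine continuous_iff_continuousAt.2 fun x => ?_
  have h1 := (hφ _ (chart_mem_atlas F x)).1.continuousAt
    ((chartAt F x).open_target.mem_nhds (mem_chart_target F x))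
  have h2 : ContinuousAt ((φ ∘ (chartAt F x).symm) ∘ chartAt F x) x :=
    ContinuousAt.comp h1 ((chartAt F x).continuousAt (mem_chart_source F x))
  refine h2.congr ?_
  filter_upwards [(chartAt F x).open_source.mem_nhds (mem_chart_source F x)] with y hy
  simp [(chartAt F x).left_inv hy]

theorem IsC1Functional.isCriticalPoint_of_isLocalMin [ContinuousAdd F] [ContinuousSMul ℝ F]
    (hφ : IsC1Functional F φ) {x : M} (hx : IsLocalMin φ x) : IsCriticalPoint F φ x := by
  refine ⟨chartAt F x, chart_mem_atlas F x, mem_chart_source F x, fun h => ?_⟩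
  obtain ⟨-, f', hf', -⟩ := hφ _ (chart_mem_atlas F x)
  have hd := hf' _ (mem_chart_target F x) h
  have hmin : IsLocalMin (φ ∘ (chartAt F x).symm) (chartAt F x x) := by
    have ht := (chartAt F x).symm.continuousAt (mem_chart_target F x)
    have hl := (chartAt F x).left_inv (mem_chart_source F x)
    rw [ContinuousAt, hl] at ht
    filter_upwards [ht.eventually hx] with y hy
    simpa [hl] using hy
  rwa [hd.eq_zero_of_isLocalMin hmin] at hd

/-- In the preferred chart at a point which is not critical, the functional decreases strictly in
some direction. -/
theorem IsC1Functional.exists_descent_direction (hφ : IsC1Functional F φ) {x : M}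
    (hx : ¬ IsCriticalPoint F φ x) :
    ∃ (h : F) (g : F → ℝ) (U : Set F), U ∈ 𝓝 (chartAt F x x) ∧ U ⊆ (chartAt F x).target ∧
      (∀ z ∈ U, HasDirDeriv (φ ∘ (chartAt F x).symm) z h (g z)) ∧ ∀ z ∈ U, g z < 0 := by
  obtain ⟨-, f', hf', hcont⟩ := hφ _ (chart_mem_atlas F x)
  have hxt := mem_chart_target F x
  obtain ⟨h, hh⟩ : ∃ h : F, f' (chartAt F x x) h < 0 := by
    by_contra! H
    refine hx ⟨chartAt F x, chart_mem_atlas F x, mem_chart_source F x, fun h => ?_⟩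
    have h0 : f' (chartAt F x x) h = 0 := by
      refine le_antisymm ?_ (H h)
      have := H (-h)
      rw [map_neg] at this
      linarith
    rw [← h0]
    exact hf' _ hxt h
  have hev : ContinuousOn (fun z => f' z h) (chartAt F x).target :=
    (continuous_eval_const h).comp_continuousOn hcont
  have hnhds := (chartAt F x).open_target.mem_nhds hxt
  have hlt := (hev.continuousAt hnhds).eventually_lt continuousAt_const hh
  exact ⟨h, fun z => f' z h, _, inter_mem hnhds hlt, inter_subset_left,
    fun z hz => hf' z hz.1 h, fun z hz => hz.2⟩

variable [IsTopologicalAddGroup F] [ContinuousSMul ℝ F]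

/-- Near a point which is not critical, the sublevel set is connected and accumulates at the
point. -/
theorem IsC1Functional.exists_isPreconnected_sublevel [LocallyConvexSpace ℝ F]
    (hφ : IsC1Functional F φ) {x : M} (hx : ¬ IsCriticalPoint F φ x) :
    x ∈ closure {z | φ z < φ x} ∧
      ∃ W, IsOpen W ∧ x ∈ W ∧ IsPreconnected (W ∩ {z | φ z < φ x}) := by
  obtain ⟨h, g, U, hU, hUt, hf, hg⟩ := hφ.exists_descent_direction hx
  set e := chartAt F x
  have hxs : x ∈ e.source := mem_chart_source F x
  obtain ⟨W, hWo, hxW, hWU, hWc, hWcl⟩ := FrechetCrit.exists_isPreconnected_sublevel hU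
    ((hφ e (chart_mem_atlas F x)).1.mono hUt) hf hg
  have hfx : (φ ∘ e.symm) (e x) = φ x := by simp [e.left_inv hxs]
  rw [hfx] at hWc hWcl
  have hWt : W ⊆ e.target := hWU.trans hUt
  have himg : e.symm '' (W ∩ {z | (φ ∘ e.symm) z < φ x}) = e.symm '' W ∩ {z | φ z < φ x} := by
    ext z
    constructor
    · rintro ⟨w, ⟨hw, hlt⟩, rfl⟩
      exact ⟨⟨w, hw, rfl⟩, hlt⟩
    · rintro ⟨⟨w, hw, rfl⟩, hlt⟩
      exact ⟨w, ⟨hw, hlt⟩, rfl⟩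
  have hcs : ContinuousOn e.symm (W ∩ {z | (φ ∘ e.symm) z < φ x}) :=
    e.continuousOn_symm.mono (inter_subset_left.trans hWt)
  refine ⟨?_, e.symm '' W, e.isOpen_image_symm_of_subset_target hWo hWt,
    ⟨e x, hxW, e.left_inv hxs⟩, himg ▸ hWc.image _ hcs⟩
  have hca : ContinuousWithinAt e.symm (W ∩ {z | (φ ∘ e.symm) z < φ x}) (e x) :=
    (e.continuousAt_symm (e.map_source hxs)).continuousWithinAt
  have := hca.mem_closure_image hWcl
  rw [himg, e.left_inv hxs] at this
  exact closure_mono inter_subset_right this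

/-- A manifold which carries a closed `C¹` functional with a point that is not critical is modelled
on a locally compact space. -/
theorem IsC1Functional.locallyCompactSpace_model [T2Space M] [SecondCountableTopology M]
    (hφ : IsC1Functional F φ) (hcl : IsClosedMap φ) {x : M} (hx : ¬ IsCriticalPoint F φ x) :
    LocallyCompactSpace F := by
  obtain ⟨h, g, U, hU, hUt, hf, hg⟩ := hφ.exists_descent_direction hx
  set e := chartAt F x
  have hfc : ContinuousOn (φ ∘ e.symm) U := (hφ e (chart_mem_atlas F x)).1.mono hUt
  obtain ⟨t₀, ht₀, V, hV, hsub⟩ := exists_smul_add_subset (interior_mem_nhds.2 hU) h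
  have hline : ∀ t ∈ Icc (0 : ℝ) t₀, e x + t • h ∈ interior U := fun t ht => by
    simpa using hsub t (abs_le.2 ⟨by linarith [ht.1], ht.2⟩) 0 (mem_of_mem_nhds hV)
  have hanti : StrictAntiOn (fun t : ℝ => (φ ∘ e.symm) (e x + t • h)) (Icc 0 t₀) :=
    strictAntiOn_of_hasDirDeriv_neg (convex_Icc _ _)
      (fun t ht => interior_subset (hline t ht)) hf hg
  have hco : ContinuousOn (fun t : ℝ => (φ ∘ e.symm) (e x + t • h)) (Icc 0 t₀) := by
    intro t ht
    exact (hf _ (interior_subset (hline t ht))).hasDerivAt.continuousAt.continuousWithinAt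
  have hlt := hanti (left_mem_Icc.2 ht₀.le) (right_mem_Icc.2 ht₀.le) ht₀
  -- The values along the descent segment fill a nonempty open interval, which is uncountable and so
  -- contains a compact level.
  obtain ⟨c, hcmem, hcK⟩ : ∃ c ∈ Ioo ((φ ∘ e.symm) (e x + t₀ • h))
      ((φ ∘ e.symm) (e x + (0 : ℝ) • h)), IsCompact (φ ⁻¹' {c}) := by
    by_contra! H
    exact (Cardinal.Real.Ioo_countable_iff.1
      ((countable_setOf_not_isCompact_level hφ.continuous hcl).mono H)).not_gt hlt
  obtain ⟨t, ht, htc⟩ := intermediate_value_Icc' ht₀.le hco (Ioo_subset_Icc_self hcmem)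
  have hyU := hline t ht
  set y := e x + t • h
  have hyt : y ∈ e.target := hUt (interior_subset hyU)
  let O : Set M := e.symm '' interior U
  have hO : IsOpen O :=
    e.isOpen_image_symm_of_subset_target isOpen_interior (interior_subset.trans hUt)
  -- The compact level may leave the chart, so it is cut down to a compact neighbourhood within the
  -- level that the chart can transport to `F`.
  obtain ⟨K, hK, hKO, hKc⟩ : ∃ K : Set (φ ⁻¹' {c}), K ∈ 𝓝 (⟨e.symm y, htc⟩ : φ ⁻¹' {c}) ∧
      K ⊆ Subtype.val ⁻¹' O ∧ IsCompact K := by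
    have : CompactSpace (φ ⁻¹' {c}) := isCompact_iff_compactSpace.1 hcK
    exact local_compact_nhds ((hO.preimage continuous_subtype_val).mem_nhds ⟨y, hyU, rfl⟩)
  obtain ⟨O', hO', hO'K⟩ := mem_nhds_subtype _ _ _ |>.1 hK
  have hOs : O ⊆ e.source := by
    rintro _ ⟨w, hw, rfl⟩
    exact e.map_target (hUt (interior_subset hw))
  have hKc' : IsCompact (e '' (Subtype.val '' K)) := by
    refine (hKc.image continuous_subtype_val).image_of_continuousOn (e.continuousOn.mono ?_)
    rintro _ ⟨w, hw, rfl⟩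
    exact hOs (hKO hw)
  have hU' : U ∩ e.symm ⁻¹' O' ∈ 𝓝 y :=
    inter_mem (mem_interior_iff_mem_nhds.1 hyU) ((e.continuousAt_symm hyt).preimage_mem_nhds hO')
  refine locallyCompactSpace_of_isCompact_level hU' (hfc.mono inter_subset_left)
    (fun z hz => hf z hz.1) (fun z hz => hg z hz.1) hKc' fun z hz hfz => ?_
  have hzc : e.symm z ∈ φ ⁻¹' {c} := by
    rw [mem_preimage, mem_singleton_iff, ← htc]
    exact hfz
  exact ⟨e.symm z, ⟨⟨e.symm z, hzc⟩, hO'K hz.2, rfl⟩, e.right_inv (hUt hz.1)⟩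

/-- A closed `C¹` functional on a connected manifold with two local minimum points has a third
critical point. -/
theorem IsC1Functional.exists_third_criticalPoint [LocallyConvexSpace ℝ F] [T2Space M]
    [SecondCountableTopology M] [ConnectedSpace M]
    (hφ : IsC1Functional F φ) (hcl : IsClosedMap φ) {x₀ x₁ : M} (hne : x₀ ≠ x₁)
    (h₀ : IsLocalMin φ x₀) (h₁ : IsLocalMin φ x₁) :
    ∃ x, x ≠ x₀ ∧ x ≠ x₁ ∧ IsCriticalPoint F φ x := by
  -- With `x₀` the higher minimum, a rim above `φ x₀` is also above `φ x₁`.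
  wlog hle : φ x₁ ≤ φ x₀ generalizing x₀ x₁
  · obtain ⟨x, hx1, hx0, hx⟩ := this hne.symm h₁ h₀ (not_le.1 hle).le
    exact ⟨x, hx0, hx1, hx⟩
  by_contra! H
  obtain ⟨p, hp⟩ : ∃ p, p ∉ ({x₀, x₁} : Set M) := by
    have hinf : (univ : Set M).Infinite :=
      isPreconnected_univ.infinite_of_nontrivial ⟨x₀, trivial, x₁, trivial, hne⟩
    obtain ⟨p, -, hp⟩ := hinf.exists_notMem_finite (toFinite {x₀, x₁})
    exact ⟨p, hp⟩
  rw [mem_insert_iff, mem_singleton_iff, not_or] at hp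
  have : LocallyCompactSpace F := hφ.locallyCompactSpace_model hcl (H p hp.1 hp.2)
  have : LocallyCompactSpace M := ChartedSpace.locallyCompactSpace F M
  have : LocallyPathConnectedSpace M := ChartedSpace.locallyPathConnectedSpace F M
  obtain ⟨V, hV, hVo, hxV⟩ := eventually_nhds_iff.1 (h₀.and (isOpen_ne.mem_nhds hne))
  obtain ⟨b, hb, hbS⟩ := exists_rim_of_strict_local_min (y := x₁) hφ.continuous
    (hVo.mem_nhds hxV) (fun h => (hV _ h).2 rfl) (fun z hz hzx => by
      refine lt_of_le_of_ne (hV z hz).1 fun heq => ?_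
      refine H z hzx (hV z hz).2 (hφ.isCriticalPoint_of_isLocalMin ?_)
      filter_upwards [hVo.mem_nhds hz] with w hw
      rw [← heq]
      exact (hV w hw).1)
  obtain ⟨q, hbq, hq⟩ := exists_mountain_pass_point hφ.continuous hcl hb (hle.trans_lt hb) hbS
  -- Since `φ q ≥ b` exceeds both minimum values, `q` differs from `x₀` and `x₁`, so it is not
  -- critical and its sublevel set is locally connected there.
  refine hq (hφ.exists_isPreconnected_sublevel (H q ?_ ?_)) <;> rintro rfl <;> linarith

end Functionals

end FrechetCrit

theorem theorem3p11
    {F : Type*} [AddCommGroup F] [Module ℝ F] [UniformSpace F] [IsUniformAddGroup F]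
    [ContinuousSMul ℝ F] [LocallyConvexSpace ℝ F] [T2Space F] [FirstCountableTopology F]
    [CompleteSpace F]
    {M : Type*} [TopologicalSpace M] [T2Space M] [SecondCountableTopology M] [ConnectedSpace M]
    [ChartedSpace F M] (hM : FrechetCrit.IsKellerC1Atlas F M)
    (N : FrechetCrit.GradedFinsler F M) (hN : N.IsCompleteMetric)
    (φ : M → ℝ) (hφ : FrechetCrit.IsC1Functional F φ) (hclosed : IsClosedMap φ)
    (hPS : ∀ c : ℝ, N.PalaisSmale φ c Set.univ)
    (x₀ x₁ : M) (hne : x₀ ≠ x₁) (h₀ : IsLocalMin φ x₀) (h₁ : IsLocalMin φ x₁) :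
    FrechetCrit.IsCriticalPoint F φ x₀ ∧ FrechetCrit.IsCriticalPoint F φ x₁ ∧
      ∃ x : M, x ≠ x₀ ∧ x ≠ x₁ ∧ FrechetCrit.IsCriticalPoint F φ x :=
  ⟨hφ.isCriticalPoint_of_isLocalMin h₀, hφ.isCriticalPoint_of_isLocalMin h₁,
    hφ.exists_third_criticalPoint hclosed hne h₀ h₁⟩
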